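/- Let $k\ge 1$ and let $\lambda_1,\dots,\lambda_k\ge 0$. A \emph{generalized counting process} (GCP) with intensities $\lambda_1,\dots,\lambda_k$ is a process $\{\mathbb M(t)\}_{t\ge0}$ with values in $\{0,1,2,\dots\}$ and almost surely nondecreasing right-continuous paths, such that $\mathbb M(0)=0$ almost surely, the increments are independent, and for $0\le s\le t$ and $n\ge 0$ \[ \mathbb P\big(\mathbb M(t)-\mathbb M(s)=n\big)=\sum_{\substack{x_1,\dots,x_k\ge 0\\ x_1+2x_2+\cdots+kx_k=n}}\ \prod_{j=1}^k\frac{(\lambda_j(t-s))^{x_j}}{x_j!}e^{-\lambda_j(t-s)} . \] A \emph{generalized Skellam process} (GSP) is $\mathcal S(t)=\mathbb M_1(t)-\mathbb M_2(t)$, where $\mathbb M_1,\mathbb M_2$ are independent GCPs with intensities $\lambda_1,\dots,\lambda_k$ and $\mu_1,\dots,\mu_k$. The \emph{running average} of a process $X$ is $X_A(t)=\frac1t\int_0^tX(u)\,du$ for $t>0$, and $X_A(0)=0$. A square-integrable process $Y$ has the \emph{long-range dependence} (LRD) property if there is $\theta\in(0,1)$ such that for every fixed $s>0$ there is $c(s)>0$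 with $\mathrm{Corr}(Y(s),Y(t))\sim c(s)\,t^{-\theta}$ as $t\to\infty$. (i) Let $\mathcal S$ be a GSP whose intensities $\lambda_1,\dots,\lambda_k,\mu_1,\dots,\mu_k$ are not all zero. Then for $0<s\le t$ \[ \mathrm{Corr}\big(\mathcal S_A(s),\mathcal S_A(t)\big)=\frac{3t-s}{2t}\,\sqrt{s}\,t^{-1/2}, \] and $\{\mathcal S_A(t)\}_{t\ge0}$ has the LRD property. (ii) Let $\mathbb M$ be a GCP whose intensities are not all zero. Then $\mathrm{Corr}(\mathbb M_A(s),\mathbb M_A(t))=\frac{3t-s}{2t}\sqrt{s}\,t^{-1/2}$ for $0<s\le t$, and $\{\mathbb M_A(t)\}_{t\ge0}$ has the LRD property. -/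

import Mathlib

open MeasureTheory ProbabilityTheory Filter Asymptotics
open scoped NNReal

noncomputable section

/-- The law of `∑_{j=1}^k j N_j` for independent Poisson variables `N_j` with means `rate_j * τ`;
the index `i : Fin k` stands for the jump size `j = i + 1`. The mass at `n` is
`∑_{x_1 + 2 x_2 + ⋯ + k x_k = n} ∏_j (rate_j τ)^{x_j} / x_j! * exp (-rate_j τ)`. -/
def gcpLaw {k : ℕ} (rate : Fin k → ℝ≥0) (τ : ℝ≥0) : Measure ℕ :=
  (Measure.pi fun i : Fin k => poissonMeasure (rate i * τ)).map
    fun x : Fin k → ℕ => ∑ i : Fin k, ((i : ℕ) + 1) * x i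

/-- `M` is a generalized counting process (GCP): a counting process with jump sizes `1, …, k`
occurring with intensities `rate_1, …, rate_k`. -/
structure IsGCP {Ω : Type*} [MeasurableSpace Ω] {k : ℕ} (M : ℝ≥0 → Ω → ℕ)
    (rate : Fin k → ℝ≥0) (P : Measure Ω) : Prop where
  measurable : ∀ t, Measurable (M t)
  start : ∀ᵐ ω ∂P, M 0 ω = 0
  paths : ∀ᵐ ω ∂P, Monotone (fun t => M t ω) ∧
    ∀ t, ContinuousWithinAt (fun u => M u ω) (Set.Ici t) t
  indep_increments : HasIndepIncrements (fun t ω => (M t ω : ℝ)) P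
  law_increments : ∀ s t : ℝ≥0, s ≤ t →
    HasLaw (fun ω => (M t ω : ℝ) - (M s ω : ℝ))
      ((gcpLaw rate (t - s)).map (Nat.cast : ℕ → ℝ)) P

/-- `S` is a generalized Skellam process (GSP): the difference of two independent GCPs.
Independence is that of the whole processes. -/
def IsGSP {Ω : Type*} [MeasurableSpace Ω] {k : ℕ} (S : ℝ≥0 → Ω → ℝ)
    (rate₁ rate₂ : Fin k → ℝ≥0) (P : Measure Ω) : Prop :=
  ∃ M₁ M₂ : ℝ≥0 → Ω → ℕ, IsGCP M₁ rate₁ P ∧ IsGCP M₂ rate₂ P ∧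
    IndepFun (fun ω t => M₁ t ω) (fun ω t => M₂ t ω) P ∧
    ∀ t ω, S t ω = (M₁ t ω : ℝ) - (M₂ t ω : ℝ)

/-- The running average `X_A(t) = (1/t) ∫₀ᵗ X(u) du`, with `X_A(0) = 0`. -/
def runningAverage {Ω : Type*} (X : ℝ≥0 → Ω → ℝ) (t : ℝ≥0) (ω : Ω) : ℝ :=
  (1 / (t : ℝ)) * ∫ u in (0 : ℝ)..(t : ℝ), X u.toNNReal ω

/-- Correlation coefficient of two real random variables. -/
def corr {Ω : Type*} [MeasurableSpace Ω] (X Y : Ω → ℝ) (P : Measure Ω) : ℝ :=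
  covariance X Y P / (√(variance X P) * √(variance Y P))

/-- Long-range dependence of a square-integrable process: for some `θ ∈ (0, 1)` and every fixed
`s > 0`, `Corr(Y(s), Y(t)) ~ c(s) t^{-θ}` as `t → ∞`, with `c(s) > 0`. -/
def HasLRD {Ω : Type*} [MeasurableSpace Ω] (Y : ℝ≥0 → Ω → ℝ) (P : Measure Ω) : Prop :=
  (∀ t, MemLp (Y t) 2 P) ∧
  ∃ θ : ℝ, 0 < θ ∧ θ < 1 ∧ ∀ s : ℝ≥0, 0 < s → ∃ c : ℝ, 0 < c ∧
    (fun t : ℝ≥0 => corr (Y s) (Y t) P) ~[atTop] (fun t : ℝ≥0 => c * (t : ℝ) ^ (-θ))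

end

/-! A GCP has independent increments and starts at 0, so Cov(M(u), M(v)) = κ min(u, v), where κ =
`gcpVar` comes from the Poisson variances. By Fubini (`covariance_integral_integral`) the averages
have covariance κ/(st) ∫₀ˢ∫₀ᵗ min(u, v) dv du = κ s(3t - s)/(6t) for s ≤ t. For a GSP the cross
terms vanish by independence and the two constants add. The diagonal gives the variance κt/3, so κ
cancels in the correlation (`corr_eq_of_covariance`). As t → ∞ the factor (3t - s)/(2t) tends to
3/2, which gives LRD with θ = 1/2.

Fubini requires joint measurability, obtained from right-continuity of the paths, and a
square-integrable bound: on (0, t] a nondecreasing path is at most M(t). -/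

/-- The factorial moments of the Poisson distribution are the powers of its rate. -/
lemma hasSum_descFactorial_poisson (r : ℝ≥0) (m : ℕ) :
    HasSum (fun n : ℕ => Real.exp (-r) * (r : ℝ) ^ n / (n.factorial : ℝ) * (n.descFactorial m : ℝ))
      ((r : ℝ) ^ m) := by
  have h := (hasSum_one_poissonMeasure r).mul_left ((r : ℝ) ^ m)
  rw [mul_one] at h
  have h0 : ∑ i ∈ Finset.range m,
      Real.exp (-r) * (r : ℝ) ^ i / (i.factorial : ℝ) * (i.descFactorial m : ℝ) = 0 :=
    Finset.sum_eq_zero fun i hi => by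
      rw [Nat.descFactorial_of_lt (Finset.mem_range.mp hi)]; simp
  -- The terms below m vanish; after the shift by m, the descending factorial turns (n + m)! into
  -- n!, leaving r^m times the Poisson mass at n.
  rw [← hasSum_nat_add_iff' m, h0, sub_zero]
  refine h.congr_fun fun n => ?_
  have h1 : (n.factorial : ℝ) * ((n + m).descFactorial m : ℝ) = ((n + m).factorial : ℝ) := by
    have := Nat.factorial_mul_descFactorial (Nat.le_add_left m n)
    rw [Nat.add_sub_cancel] at this
    exact_mod_cast this
  have h2 : (n.factorial : ℝ) ≠ 0 := by positivity
  have h3 : ((n + m).factorial : ℝ) ≠ 0 := by positivity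
  rw [← h1] at h3 ⊢
  have h4 := right_ne_zero_of_mul h3
  field_simp
  ring

lemma hasSum_natCast_poisson (r : ℝ≥0) :
    HasSum (fun n : ℕ => Real.exp (-r) * (r : ℝ) ^ n / (n.factorial : ℝ) * (n : ℝ)) r := by
  simpa using hasSum_descFactorial_poisson r 1

lemma hasSum_natCast_sq_poisson (r : ℝ≥0) :
    HasSum (fun n : ℕ => Real.exp (-r) * (r : ℝ) ^ n / (n.factorial : ℝ) * (n : ℝ) ^ 2)
      ((r : ℝ) ^ 2 + r) := by
  refine ((hasSum_descFactorial_poisson r 2).add (hasSum_natCast_poisson r)).congr_fun fun n => ?_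
  have : (n : ℝ) ^ 2 = (n.descFactorial 2 : ℝ) + n := by
    rcases n with _ | n
    · simp
    · simp [Nat.descFactorial]; ring
  rw [this]; ring

lemma memLp_natCast_poissonMeasure (r : ℝ≥0) :
    MemLp (fun n : ℕ => (n : ℝ)) 2 (poissonMeasure r) := by
  rw [memLp_two_iff_integrable_sq .of_discrete, integrable_poissonMeasure_iff]
  simpa using (hasSum_natCast_sq_poisson r).summable

lemma integral_natCast_poissonMeasure (r : ℝ≥0) :
    ∫ n, (n : ℝ) ∂(poissonMeasure r) = r := by
  rw [integral_poissonMeasure]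
  simpa using (hasSum_natCast_poisson r).tsum_eq

lemma variance_natCast_poissonMeasure (r : ℝ≥0) :
    variance (fun n : ℕ => (n : ℝ)) (poissonMeasure r) = r := by
  rw [variance_eq_sub (memLp_natCast_poissonMeasure r), integral_natCast_poissonMeasure,
    integral_poissonMeasure]
  have := (hasSum_natCast_sq_poisson r).tsum_eq
  simp only [smul_eq_mul, Pi.pow_apply]
  rw [this]; ring

/-- The variance of a generalized counting process per unit of time. -/
noncomputable def gcpVar {k : ℕ} (rate : Fin k → ℝ≥0) : ℝ :=
  ∑ i : Fin k, ((i : ℝ) + 1) ^ 2 * rate i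

lemma gcpVar_nonneg {k : ℕ} (rate : Fin k → ℝ≥0) : 0 ≤ gcpVar rate :=
  Finset.sum_nonneg fun i _ => by positivity

lemma gcpVar_pos {k : ℕ} {rate : Fin k → ℝ≥0} (h : ∃ i, 0 < rate i) : 0 < gcpVar rate := by
  obtain ⟨i, hi⟩ := h
  refine Finset.sum_pos' (fun i _ => by positivity) ⟨i, Finset.mem_univ _, ?_⟩
  have : (0 : ℝ) < rate i := by exact_mod_cast hi
  positivity

/-! ### Second moments of the GCP marginal law -/

section Law

variable {k : ℕ} (rate : Fin k → ℝ≥0) (τ : ℝ≥0)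

lemma memLp_mul_natCast_poissonMeasure (i : Fin k) :
    MemLp (fun n : ℕ => ((i : ℝ) + 1) * (n : ℝ)) 2 (poissonMeasure (rate i * τ)) :=
  (memLp_natCast_poissonMeasure _).const_mul _

lemma memLp_mul_eval_pi_poissonMeasure (i : Fin k) :
    MemLp (fun x : Fin k → ℕ => ((i : ℝ) + 1) * (x i : ℝ)) 2
      (Measure.pi fun i : Fin k => poissonMeasure (rate i * τ)) :=
  (memLp_mul_natCast_poissonMeasure rate τ i).comp_measurePreserving
    (measurePreserving_eval (fun i : Fin k => poissonMeasure (rate i * τ)) i)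

lemma natCast_comp_weightedSum :
    ((fun n : ℕ => (n : ℝ)) ∘ fun x : Fin k → ℕ => ∑ i : Fin k, ((i : ℕ) + 1) * x i) =
      ∑ i : Fin k, fun x : Fin k → ℕ => ((i : ℝ) + 1) * (x i : ℝ) := by
  ext x; simp [Finset.sum_apply]

lemma memLp_natCast_gcpLaw : MemLp (fun n : ℕ => (n : ℝ)) 2 (gcpLaw rate τ) := by
  rw [gcpLaw, memLp_map_measure_iff .of_discrete (Measurable.of_discrete).aemeasurable,
    natCast_comp_weightedSum]
  exact memLp_finsetSum' _ fun i _ => memLp_mul_eval_pi_poissonMeasure rate τ i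

lemma variance_natCast_gcpLaw :
    variance (fun n : ℕ => (n : ℝ)) (gcpLaw rate τ) = gcpVar rate * τ := by
  rw [gcpLaw, variance_map .of_discrete (Measurable.of_discrete).aemeasurable,
    natCast_comp_weightedSum,
    variance_sum_pi (μ := fun i : Fin k => poissonMeasure (rate i * τ))
      (X := fun (i : Fin k) (n : ℕ) => ((i : ℝ) + 1) * (n : ℝ))
      (fun i => memLp_mul_natCast_poissonMeasure rate τ i), gcpVar, Finset.sum_mul]
  refine Finset.sum_congr rfl fun i _ => ?_
  rw [variance_const_mul, variance_natCast_poissonMeasure]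
  push_cast; ring

end Law

/-! ### Covariance function and joint measurability of a GCP -/

section CountingPaths

variable {Ω : Type*} [MeasurableSpace Ω] {P : Measure Ω} {k : ℕ} {M : ℝ≥0 → Ω → ℕ}
  {rate : Fin k → ℝ≥0}

lemma IsGCP.hasLaw_eval (h : IsGCP M rate P) (t : ℝ≥0) :
    HasLaw (fun ω => (M t ω : ℝ)) ((gcpLaw rate t).map (Nat.cast : ℕ → ℝ)) P := by
  have h1 := h.law_increments 0 t zero_le
  rw [tsub_zero] at h1
  refine h1.congr ?_
  filter_upwards [h.start] with ω hω
  simp [hω]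

lemma IsGCP.memLp_eval (h : IsGCP M rate P) (t : ℝ≥0) :
    MemLp (fun ω => (M t ω : ℝ)) 2 P := by
  have hl := h.hasLaw_eval t
  have h1 : MemLp id 2 (P.map fun ω => (M t ω : ℝ)) := by
    rw [hl.map_eq, memLp_map_measure_iff aestronglyMeasurable_id
      (Measurable.of_discrete).aemeasurable]
    exact memLp_natCast_gcpLaw rate t
  exact (memLp_map_measure_iff aestronglyMeasurable_id hl.aemeasurable).mp h1

lemma IsGCP.variance_eval (h : IsGCP M rate P) (t : ℝ≥0) :
    variance (fun ω => (M t ω : ℝ)) P = gcpVar rate * t := by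
  rw [(h.hasLaw_eval t).variance_eq,
    variance_map aemeasurable_id (Measurable.of_discrete).aemeasurable]
  exact variance_natCast_gcpLaw rate t

/-- M(s) is the increment over [0, s], hence independent of M(t) - M(s); only Var M(s) survives. -/
lemma IsGCP.covariance_eval_of_le [IsProbabilityMeasure P] (h : IsGCP M rate P) {s t : ℝ≥0}
    (hst : s ≤ t) :
    covariance (fun ω => (M s ω : ℝ)) (fun ω => (M t ω : ℝ)) P = gcpVar rate * s := by
  have hs := h.memLp_eval s
  have ht := h.memLp_eval t
  have hind := (h.indep_increments.indepFun_eval_sub (zero_le (a := s)) hst (by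
    filter_upwards [h.start] with ω hω using by simp [hω])).covariance_eq_zero hs (ht.sub hs)
  rw [covariance_sub_right hs ht hs, covariance_self hs.aemeasurable, h.variance_eval] at hind
  linarith

lemma IsGCP.covariance_eval [IsProbabilityMeasure P] (h : IsGCP M rate P) (s t : ℝ≥0) :
    covariance (fun ω => (M s ω : ℝ)) (fun ω => (M t ω : ℝ)) P =
      gcpVar rate * min (s : ℝ) t := by
  rcases le_total s t with hst | hst
  · rw [h.covariance_eval_of_le hst, min_eq_left (by exact_mod_cast hst)]
  · rw [covariance_comm, h.covariance_eval_of_le hst, min_eq_right (by exact_mod_cast hst)]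

/-- The grid points `(⌊n x⌋ + 1) / n` approach `x` from the right. -/
lemma tendsto_floor_mul_succ_div (x : ℝ≥0) :
    Tendsto (fun n : ℕ => ((⌊((n : ℝ≥0) + 1) * x⌋₊ : ℝ≥0) + 1) / ((n : ℝ≥0) + 1)) atTop
      (nhdsWithin x (Set.Ici x)) := by
  have hlow : ∀ n : ℕ, x ≤ ((⌊((n : ℝ≥0) + 1) * x⌋₊ : ℝ≥0) + 1) / ((n : ℝ≥0) + 1) := fun n => by
    rw [le_div_iff₀ (by positivity), mul_comm]
    exact (Nat.lt_floor_add_one _).le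
  have hupp : ∀ n : ℕ, ((⌊((n : ℝ≥0) + 1) * x⌋₊ : ℝ≥0) + 1) / ((n : ℝ≥0) + 1) ≤
      x + 1 / ((n : ℝ≥0) + 1) := fun n => by
    rw [div_le_iff₀ (by positivity), add_mul x, one_div, inv_mul_cancel₀ (by positivity), mul_comm x]
    gcongr
    exact Nat.floor_le zero_le
  refine tendsto_nhdsWithin_iff.mpr ⟨?_, Eventually.of_forall hlow⟩
  refine tendsto_of_tendsto_of_tendsto_of_le_of_le tendsto_const_nhds ?_ hlow hupp
  simpa using tendsto_const_nhds.add (tendsto_one_div_add_atTop_nhds_zero_nat (𝕜 := ℝ≥0))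

/-- A process with almost surely right-continuous paths, evaluated at a measurable time, is almost
everywhere equal to a measurable function. -/
lemma IsGCP.aestronglyMeasurable_comp (h : IsGCP M rate P) {α : Type*} [MeasurableSpace α]
    {μ : Measure α} {τ : α → ℝ≥0} {π : α → Ω} (hτ : Measurable τ)
    (hπ : Measure.QuasiMeasurePreserving π μ P) :
    AEStronglyMeasurable (fun a => (M (τ a) (π a) : ℝ)) μ := by
  let g : ℕ → ℝ≥0 → ℝ≥0 := fun n x =>
    ((⌊((n : ℝ≥0) + 1) * x⌋₊ : ℝ≥0) + 1) / ((n : ℝ≥0) + 1)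
  refine aestronglyMeasurable_of_tendsto_ae (u := atTop)
    (f := fun n a => (M (g n (τ a)) (π a) : ℝ)) (fun n => ?_) ?_
  -- For fixed n the grid time takes countably many values, so measurability of each M(t) suffices.
  · have h1 : Measurable fun p : Ω × ℕ => M (((p.2 : ℝ≥0) + 1) / ((n : ℝ≥0) + 1)) p.1 :=
      measurable_from_prod_countable_left fun m => h.measurable ((m + 1) / (n + 1))
    have h2 : Measurable fun a => (π a, ⌊((n : ℝ≥0) + 1) * τ a⌋₊) :=
      hπ.measurable.prodMk (hτ.const_mul _).nat_floor
    have h3 := h1.comp h2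
    exact ((Measurable.of_discrete (f := (Nat.cast : ℕ → ℝ))).comp h3).aestronglyMeasurable
  · filter_upwards [hπ.ae h.paths] with a ha
    exact ((continuous_of_discreteTopology (f := (Nat.cast : ℕ → ℝ))).tendsto _).comp
      ((ha.2 (τ a)).tendsto.comp (tendsto_floor_mul_succ_div (τ a)))

end CountingPaths

/-! ### Exchanging covariance and integration -/

section Fubini

variable {Ω α β : Type*} [MeasurableSpace Ω] [MeasurableSpace α] [MeasurableSpace β]
  {P : Measure Ω} {ν : Measure α} [IsFiniteMeasure ν]
  {ν' : Measure β} [IsFiniteMeasure ν'] {X : α → Ω → ℝ} {Y : β → Ω → ℝ} {D D' : Ω → ℝ}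

lemma memLp_integral_of_dominated
    (hX : AEStronglyMeasurable (fun p : Ω × α => X p.2 p.1) (P.prod ν))
    (hD : MemLp D 2 P) (hXD : ∀ᵐ ω ∂P, ∀ᵐ a ∂ν, |X a ω| ≤ D ω) :
    MemLp (fun ω => ∫ a, X a ω ∂ν) 2 P := by
  refine (hD.const_mul (ν.real Set.univ)).mono hX.integral_prod_right' ?_
  filter_upwards [hXD] with ω hω
  refine (norm_integral_le_of_norm_le_const (C := D ω) ?_).trans ?_
  · filter_upwards [hω] with a ha using by simpa using ha
  · rw [mul_comm]; exact Real.le_norm_self _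

lemma integrable_uncurry_of_dominated
    (hX : AEStronglyMeasurable (fun p : Ω × α => X p.2 p.1) (P.prod ν))
    (hD : Integrable D P) (hXD : ∀ᵐ ω ∂P, ∀ᵐ a ∂ν, |X a ω| ≤ D ω) :
    Integrable (fun p : Ω × α => X p.2 p.1) (P.prod ν) := by
  have hD' : Integrable (fun ω => ν.real Set.univ * D ω) P := hD.const_mul _
  rw [integrable_prod_iff hX]
  have hs : ∀ᵐ ω ∂P, Integrable (fun a => X a ω) ν := by
    filter_upwards [hXD, hX.prodMk_left] with ω hω hm
    exact Integrable.of_bound hm (D ω) (by simpa using hω)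
  refine ⟨hs, hD'.mono hX.norm.integral_prod_right' ?_⟩
  filter_upwards [hXD] with ω hω
  refine (norm_integral_le_of_norm_le_const (C := D ω) ?_).trans ?_
  · filter_upwards [hω] with a ha using by simpa using ha
  · rw [mul_comm]; exact Real.le_norm_self _

/-- The covariance of two integrals of square-dominated processes is the double integral of the
covariance function. -/
lemma covariance_integral_integral [IsProbabilityMeasure P]
    (hX : AEStronglyMeasurable (fun p : Ω × α => X p.2 p.1) (P.prod ν))
    (hY : AEStronglyMeasurable (fun p : Ω × β => Y p.2 p.1) (P.prod ν'))
    (hX2 : ∀ a, MemLp (X a) 2 P) (hY2 : ∀ b, MemLp (Y b) 2 P)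
    (hD : MemLp D 2 P) (hD' : MemLp D' 2 P)
    (hXD : ∀ᵐ ω ∂P, ∀ᵐ a ∂ν, |X a ω| ≤ D ω) (hYD : ∀ᵐ ω ∂P, ∀ᵐ b ∂ν', |Y b ω| ≤ D' ω) :
    covariance (fun ω => ∫ a, X a ω ∂ν) (fun ω => ∫ b, Y b ω ∂ν') P =
      ∫ a, ∫ b, covariance (X a) (Y b) P ∂ν' ∂ν := by
  have hXi := integrable_uncurry_of_dominated hX (hD.integrable one_le_two) hXD
  have hYi := integrable_uncurry_of_dominated hY (hD'.integrable one_le_two) hYD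
  -- The product is dominated by `D * D'`, integrable by Cauchy–Schwarz; this licenses Fubini on the
  -- triple product.
  have hXYi : Integrable (fun p : Ω × α × β => X p.2.1 p.1 * Y p.2.2 p.1)
      (P.prod (ν.prod ν')) := by
    refine integrable_uncurry_of_dominated (X := fun (q : α × β) ω => X q.1 ω * Y q.2 ω)
      (D := fun ω => D ω * D' ω) ?_ (hD.integrable_mul hD') ?_
    · have h1 : Measure.QuasiMeasurePreserving (fun p : Ω × α × β => (p.1, p.2.1))
          (P.prod (ν.prod ν')) (P.prod ν) :=
        MeasureTheory.QuasiMeasurePreserving.prodMap (.id P) Measure.quasiMeasurePreserving_fst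
      have h2 : Measure.QuasiMeasurePreserving (fun p : Ω × α × β => (p.1, p.2.2))
          (P.prod (ν.prod ν')) (P.prod ν') :=
        MeasureTheory.QuasiMeasurePreserving.prodMap (.id P) Measure.quasiMeasurePreserving_snd
      exact (hX.comp_quasiMeasurePreserving h1).mul (hY.comp_quasiMeasurePreserving h2)
    · filter_upwards [hXD, hYD] with ω h1 h2
      filter_upwards [Measure.quasiMeasurePreserving_fst.ae h1,
        Measure.quasiMeasurePreserving_snd.ae h2] with q hq1 hq2
      rw [abs_mul]
      exact mul_le_mul hq1 hq2 (abs_nonneg _) ((abs_nonneg _).trans hq1)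
  have hcov : ∀ q : α × β, covariance (X q.1) (Y q.2) P =
      ∫ ω, X q.1 ω * Y q.2 ω ∂P - (∫ ω, X q.1 ω ∂P) * ∫ ω, Y q.2 ω ∂P := fun q =>
    covariance_eq_sub (hX2 q.1) (hY2 q.2)
  have hi1 : Integrable (fun q : α × β => ∫ ω, X q.1 ω * Y q.2 ω ∂P) (ν.prod ν') :=
    hXYi.integral_prod_right
  have hi2 : Integrable (fun q : α × β => (∫ ω, X q.1 ω ∂P) * ∫ ω, Y q.2 ω ∂P) (ν.prod ν') :=
    hXi.integral_prod_right.mul_prod hYi.integral_prod_right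
  have hi3 : Integrable (fun q : α × β => covariance (X q.1) (Y q.2) P) (ν.prod ν') := by
    simp_rw [hcov]; exact hi1.sub hi2
  rw [← integral_prod (fun q : α × β => covariance (X q.1) (Y q.2) P) hi3]
  simp_rw [hcov]
  rw [integral_sub hi1 hi2,
    integral_prod_mul (fun a => ∫ ω, X a ω ∂P) (fun b => ∫ ω, Y b ω ∂P),
    covariance_eq_sub (memLp_integral_of_dominated hX hD hXD)
      (memLp_integral_of_dominated hY hD' hYD),
    integral_integral_swap (f := fun ω a => X a ω) hXi,
    integral_integral_swap (f := fun ω b => Y b ω) hYi,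
    ← integral_integral_swap (f := fun ω (q : α × β) => X q.1 ω * Y q.2 ω) hXYi]
  congr 1
  exact integral_congr_ae (ae_of_all _ fun ω =>
    (integral_prod_mul (fun a => X a ω) (fun b => Y b ω)).symm)

end Fubini

lemma runningAverage_eq_setIntegral {Ω : Type*} (X : ℝ≥0 → Ω → ℝ) (t : ℝ≥0) :
    runningAverage X t =
      fun ω => (1 / (t : ℝ)) * ∫ u in Set.Ioc (0 : ℝ) t, X u.toNNReal ω := by
  ext ω
  rw [runningAverage, intervalIntegral.integral_of_le (NNReal.coe_nonneg t)]

/-! ### Covariances of running averages -/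

section RunningAverage

variable {Ω : Type*} [MeasurableSpace Ω] {P : Measure Ω} {k : ℕ} {M N : ℝ≥0 → Ω → ℕ}
  {rate rate' : Fin k → ℝ≥0}

lemma IsGCP.aestronglyMeasurable_uncurry (h : IsGCP M rate P) (ν : Measure ℝ) [SFinite ν] :
    AEStronglyMeasurable (fun p : Ω × ℝ => (M p.2.toNNReal p.1 : ℝ)) (P.prod ν) :=
  h.aestronglyMeasurable_comp (measurable_real_toNNReal.comp measurable_snd)
    Measure.quasiMeasurePreserving_fst

lemma IsGCP.ae_abs_le (h : IsGCP M rate P) (t : ℝ≥0) :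
    ∀ᵐ ω ∂P, ∀ᵐ u ∂(volume.restrict (Set.Ioc (0 : ℝ) t)),
      |(M u.toNNReal ω : ℝ)| ≤ (M t ω : ℝ) := by
  filter_upwards [h.paths] with ω hω
  filter_upwards [ae_restrict_mem measurableSet_Ioc] with u hu
  rw [Nat.abs_cast, Nat.cast_le]
  exact hω.1 (Real.toNNReal_le_iff_le_coe.mpr hu.2)

lemma IsGCP.memLp_runningAverage (h : IsGCP M rate P) (t : ℝ≥0) :
    MemLp (runningAverage (fun u ω => (M u ω : ℝ)) t) 2 P := by
  rw [runningAverage_eq_setIntegral]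
  exact (memLp_integral_of_dominated (X := fun u ω => (M (Real.toNNReal u) ω : ℝ))
    (h.aestronglyMeasurable_uncurry _) (h.memLp_eval t) (h.ae_abs_le t)).const_mul _

lemma IsGCP.integrableOn_path (h : IsGCP M rate P) (t : ℝ≥0) :
    ∀ᵐ ω ∂P, IntegrableOn (fun u : ℝ => (M u.toNNReal ω : ℝ)) (Set.Ioc (0 : ℝ) t) := by
  filter_upwards [h.paths] with ω hω
  have hm : Monotone fun u : ℝ => (M u.toNNReal ω : ℝ) := fun u v huv =>
    Nat.cast_le.mpr (hω.1 (Real.toNNReal_mono huv))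
  exact ((hm.monotoneOn _).integrableOn_isCompact isCompact_Icc).mono_set Set.Ioc_subset_Icc_self

lemma IsGCP.covariance_runningAverage [IsProbabilityMeasure P] (h : IsGCP M rate P)
    (h' : IsGCP N rate' P) (s t : ℝ≥0) :
    covariance (runningAverage (fun u ω => (M u ω : ℝ)) s)
      (runningAverage (fun u ω => (N u ω : ℝ)) t) P =
      (1 / (s : ℝ)) * ((1 / (t : ℝ)) * ∫ u in Set.Ioc (0 : ℝ) s, ∫ v in Set.Ioc (0 : ℝ) t,
        covariance (fun ω => (M u.toNNReal ω : ℝ)) (fun ω => (N v.toNNReal ω : ℝ)) P) := by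
  rw [runningAverage_eq_setIntegral, runningAverage_eq_setIntegral, covariance_const_mul_left,
    covariance_const_mul_right, covariance_integral_integral
      (X := fun u ω => (M (Real.toNNReal u) ω : ℝ)) (Y := fun u ω => (N (Real.toNNReal u) ω : ℝ))
      (h.aestronglyMeasurable_uncurry _) (h'.aestronglyMeasurable_uncurry _)
      (fun u => h.memLp_eval _) (fun u => h'.memLp_eval _) (h.memLp_eval s) (h'.memLp_eval t)
      (h.ae_abs_le s) (h'.ae_abs_le t)]

lemma integral_min_of_mem {u t : ℝ} (hu : 0 ≤ u) (hut : u ≤ t) :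
    ∫ v in (0 : ℝ)..t, min u v = u * t - u ^ 2 / 2 := by
  have hc : Continuous fun v : ℝ => min u v := by fun_prop
  rw [← intervalIntegral.integral_add_adjacent_intervals (hc.intervalIntegrable 0 u)
    (hc.intervalIntegrable u t)]
  have h1 : ∫ v in (0 : ℝ)..u, min u v = ∫ v in (0 : ℝ)..u, v :=
    intervalIntegral.integral_congr fun v hv => by
      rw [Set.uIcc_of_le hu] at hv; exact min_eq_right hv.2
  have h2 : ∫ v in u..t, min u v = ∫ _ in u..t, u :=
    intervalIntegral.integral_congr fun v hv => by
      rw [Set.uIcc_of_le hut] at hv; exact min_eq_left hv.1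
  rw [h1, h2, integral_id, intervalIntegral.integral_const, smul_eq_mul]
  ring

lemma integral_integral_min {s t : ℝ} (hs : 0 ≤ s) (hst : s ≤ t) :
    ∫ u in Set.Ioc 0 s, ∫ v in Set.Ioc 0 t, min u v = s ^ 2 * t / 2 - s ^ 3 / 6 := by
  have h1 : ∀ u ∈ Set.Ioc 0 s, ∫ v in Set.Ioc 0 t, min u v = u * t - u ^ 2 / 2 := fun u hu => by
    rw [← intervalIntegral.integral_of_le (hs.trans hst),
      integral_min_of_mem hu.1.le (hu.2.trans hst)]
  rw [setIntegral_congr_fun measurableSet_Ioc h1, ← intervalIntegral.integral_of_le hs,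
    intervalIntegral.integral_sub
      (Continuous.intervalIntegrable (by fun_prop) _ _)
      (Continuous.intervalIntegrable (by fun_prop) _ _),
    intervalIntegral.integral_mul_const, intervalIntegral.integral_div, integral_id, integral_pow]
  norm_num
  ring

lemma IsGCP.covariance_runningAverage_self [IsProbabilityMeasure P] (h : IsGCP M rate P)
    {s t : ℝ≥0} (hs : 0 < s) (hst : s ≤ t) :
    covariance (runningAverage (fun u ω => (M u ω : ℝ)) s)
      (runningAverage (fun u ω => (M u ω : ℝ)) t) P =
      gcpVar rate * (s * (3 * t - s) / (6 * t)) := by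
  have hs' : (0 : ℝ) < s := by exact_mod_cast hs
  have hst' : (s : ℝ) ≤ t := by exact_mod_cast hst
  have ht' : (0 : ℝ) < t := hs'.trans_le hst'
  rw [h.covariance_runningAverage h]
  have h1 : ∫ u in Set.Ioc (0 : ℝ) s, ∫ v in Set.Ioc (0 : ℝ) t,
      covariance (fun ω => (M u.toNNReal ω : ℝ)) (fun ω => (M v.toNNReal ω : ℝ)) P =
      ∫ u in Set.Ioc (0 : ℝ) s, gcpVar rate * ∫ v in Set.Ioc (0 : ℝ) t, min u v := by
    refine setIntegral_congr_fun measurableSet_Ioc fun u hu => ?_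
    rw [← integral_const_mul]
    refine setIntegral_congr_fun measurableSet_Ioc fun v hv => ?_
    rw [h.covariance_eval, Real.coe_toNNReal _ hu.1.le, Real.coe_toNNReal _ hv.1.le]
  rw [h1, integral_const_mul, integral_integral_min hs'.le hst']
  field_simp
  ring

lemma IsGCP.covariance_runningAverage_of_indepFun [IsProbabilityMeasure P] (h : IsGCP M rate P)
    (h' : IsGCP N rate' P) (hind : IndepFun (fun ω t => M t ω) (fun ω t => N t ω) P)
    (s t : ℝ≥0) :
    covariance (runningAverage (fun u ω => (M u ω : ℝ)) s)
      (runningAverage (fun u ω => (N u ω : ℝ)) t) P = 0 := by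
  have h0 : ∀ u v : ℝ≥0,
      covariance (fun ω => (M u ω : ℝ)) (fun ω => (N v ω : ℝ)) P = 0 := fun u v => by
    have hcast : ∀ w : ℝ≥0, Measurable fun x : ℝ≥0 → ℕ => (x w : ℝ) := fun w =>
      (Measurable.of_discrete (f := (Nat.cast : ℕ → ℝ))).comp (measurable_pi_apply w)
    exact (hind.comp (hcast u) (hcast v)).covariance_eq_zero (h.memLp_eval u) (h'.memLp_eval v)
  simp [h.covariance_runningAverage h', h0]

/-- Splitting the integral needs integrable paths, which monotonicity provides only almost surely.
-/
lemma runningAverage_sub_ae_eq (h : IsGCP M rate P)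
    (h' : IsGCP N rate' P) (t : ℝ≥0) :
    runningAverage (fun u ω => (M u ω : ℝ) - (N u ω : ℝ)) t =ᵐ[P]
      runningAverage (fun u ω => (M u ω : ℝ)) t - runningAverage (fun u ω => (N u ω : ℝ)) t := by
  filter_upwards [h.integrableOn_path t, h'.integrableOn_path t] with ω h1 h2
  simp only [runningAverage_eq_setIntegral, Pi.sub_apply]
  rw [integral_sub h1 h2, mul_sub]

end RunningAverage

/-! ### Correlation and its asymptotics -/

section Correlation

variable {Ω : Type*} [MeasurableSpace Ω] {P : Measure Ω}

lemma covariance_congr_ae {X X' Y Y' : Ω → ℝ} (hX : X =ᵐ[P] X') (hY : Y =ᵐ[P] Y') :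
    covariance X Y P = covariance X' Y' P := by
  rw [covariance, covariance, integral_congr_ae hX, integral_congr_ae hY]
  refine integral_congr_ae ?_
  filter_upwards [hX, hY] with ω h1 h2 using by rw [h1, h2]

/-- The correlation of a process whose covariance function is that of an averaged process with
stationary independent increments. -/
lemma corr_eq_of_covariance {Y : ℝ≥0 → Ω → ℝ} {κ : ℝ} (hκ : 0 < κ)
    (hY : ∀ t, MemLp (Y t) 2 P)
    (hcov : ∀ s t : ℝ≥0, 0 < s → s ≤ t →
      covariance (Y s) (Y t) P = κ * (s * (3 * t - s) / (6 * t)))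
    {s t : ℝ≥0} (hs : 0 < s) (hst : s ≤ t) :
    corr (Y s) (Y t) P =
      (3 * (t : ℝ) - s) / (2 * t) * (√(s : ℝ) * (t : ℝ) ^ (-(1 / 2) : ℝ)) := by
  have hvar : ∀ r : ℝ≥0, 0 < r → variance (Y r) P = κ / 3 * r := fun r hr => by
    have hr' : (0 : ℝ) < r := by exact_mod_cast hr
    rw [← covariance_self (hY r).aemeasurable, hcov r r hr le_rfl]
    field_simp
    ring
  have hs' : (0 : ℝ) < s := by exact_mod_cast hs
  have ht : 0 < t := hs.trans_le hst
  have ht' : (0 : ℝ) < t := by exact_mod_cast ht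
  rw [corr, hcov s t hs hst, hvar s hs, hvar t ht, Real.sqrt_mul (by positivity),
    Real.sqrt_mul (by positivity), Real.rpow_neg ht'.le, ← Real.sqrt_eq_rpow]
  have h1 : √(κ / 3) * √(s : ℝ) * (√(κ / 3) * √(t : ℝ)) = κ / 3 * (√(s : ℝ) * √(t : ℝ)) := by
    rw [mul_mul_mul_comm, Real.mul_self_sqrt (by positivity)]
  have h2 : √(s : ℝ) ^ 2 = s := Real.sq_sqrt hs'.le
  have h3 : √(s : ℝ) ≠ 0 := by positivity
  have h4 : √(t : ℝ) ≠ 0 := by positivity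
  rw [h1]
  field_simp
  rw [h2]
  ring

lemma hasLRD_of_corr {Y : ℝ≥0 → Ω → ℝ} (hY : ∀ t, MemLp (Y t) 2 P)
    (hcorr : ∀ s t : ℝ≥0, 0 < s → s ≤ t → corr (Y s) (Y t) P =
      (3 * (t : ℝ) - s) / (2 * t) * (√(s : ℝ) * (t : ℝ) ^ (-(1 / 2) : ℝ))) :
    HasLRD Y P := by
  refine ⟨hY, 1 / 2, by norm_num, by norm_num, fun s hs => ?_⟩
  have hs' : (0 : ℝ) < s := by exact_mod_cast hs
  refine ⟨3 / 2 * √(s : ℝ), by positivity, ?_⟩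
  refine isEquivalent_of_tendsto_one ?_
  -- For t ≥ s the ratio of the correlation to (3/2)√s t^(-1/2) is exactly 1 - s/(3t).
  have hlim : Tendsto (fun t : ℝ≥0 => 1 - (s : ℝ) / 3 * (t : ℝ)⁻¹) atTop (nhds 1) := by
    have : Tendsto (fun t : ℝ≥0 => (t : ℝ)⁻¹) atTop (nhds 0) :=
      tendsto_inv_atTop_zero.comp (NNReal.tendsto_coe_atTop.mpr tendsto_id)
    simpa using tendsto_const_nhds.sub (this.const_mul ((s : ℝ) / 3))
  refine hlim.congr' ?_
  filter_upwards [eventually_ge_atTop s] with t hst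
  have ht' : (0 : ℝ) < t := by exact_mod_cast hs.trans_le hst
  have h1 : (t : ℝ) ^ (-(1 / 2) : ℝ) ≠ 0 := (Real.rpow_pos_of_pos ht' _).ne'
  have h2 : √(s : ℝ) ≠ 0 := by positivity
  simp only [Pi.div_apply]
  rw [hcorr s t hs hst]
  generalize (t : ℝ) ^ (-(1 / 2) : ℝ) = z at h1
  field_simp

end Correlation

theorem mainTheorem13 {Ω : Type*} [MeasurableSpace Ω] (P : Measure Ω) [IsProbabilityMeasure P]
    (k : ℕ) :
    (∀ (S : ℝ≥0 → Ω → ℝ) (rate₁ rate₂ : Fin k → ℝ≥0), IsGSP S rate₁ rate₂ P →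
      (∃ i, 0 < rate₁ i ∨ 0 < rate₂ i) →
      (∀ s t : ℝ≥0, 0 < s → s ≤ t →
        corr (runningAverage S s) (runningAverage S t) P =
          (3 * (t : ℝ) - s) / (2 * t) * (√(s : ℝ) * (t : ℝ) ^ (-(1 / 2) : ℝ))) ∧
      HasLRD (runningAverage S) P) ∧
    (∀ (M : ℝ≥0 → Ω → ℕ) (rate : Fin k → ℝ≥0), IsGCP M rate P →
      (∃ i, 0 < rate i) →
      (∀ s t : ℝ≥0, 0 < s → s ≤ t →
        corr (runningAverage (fun u ω => (M u ω : ℝ)) s)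
            (runningAverage (fun u ω => (M u ω : ℝ)) t) P =
          (3 * (t : ℝ) - s) / (2 * t) * (√(s : ℝ) * (t : ℝ) ^ (-(1 / 2) : ℝ))) ∧
      HasLRD (runningAverage fun u ω => (M u ω : ℝ)) P) := by
  -- Both parts reduce to this covariance shape; they differ only in κ.
  have key : ∀ (Y : ℝ≥0 → Ω → ℝ) (κ : ℝ), 0 < κ → (∀ t, MemLp (Y t) 2 P) →
      (∀ s t : ℝ≥0, 0 < s → s ≤ t →
        covariance (Y s) (Y t) P = κ * (s * (3 * t - s) / (6 * t))) →
      (∀ s t : ℝ≥0, 0 < s → s ≤ t → corr (Y s) (Y t) P =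
        (3 * (t : ℝ) - s) / (2 * t) * (√(s : ℝ) * (t : ℝ) ^ (-(1 / 2) : ℝ))) ∧ HasLRD Y P :=
    fun Y κ hκ hY hcov =>
      have hcorr := fun s t hs hst => corr_eq_of_covariance (s := s) (t := t) hκ hY hcov hs hst
      ⟨hcorr, hasLRD_of_corr hY hcorr⟩
  refine ⟨?_, fun M rate hM hrate => key _ _ (gcpVar_pos hrate) hM.memLp_runningAverage
    fun s t hs hst => hM.covariance_runningAverage_self hs hst⟩
  rintro S rate₁ rate₂ ⟨M₁, M₂, h₁, h₂, hind, hS⟩ hrate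
  obtain rfl : S = fun u ω => (M₁ u ω : ℝ) - (M₂ u ω : ℝ) := funext₂ hS
  have hsub := fun t => runningAverage_sub_ae_eq h₁ h₂ t
  have hm₁ := h₁.memLp_runningAverage
  have hm₂ := h₂.memLp_runningAverage
  refine key _ (gcpVar rate₁ + gcpVar rate₂) ?_
    (fun t => ((hm₁ t).sub (hm₂ t)).ae_eq (hsub t).symm) fun s t hs hst => ?_
  · obtain ⟨i, hi | hi⟩ := hrate
    · exact add_pos_of_pos_of_nonneg (gcpVar_pos ⟨i, hi⟩) (gcpVar_nonneg _)
    · exact add_pos_of_nonneg_of_pos (gcpVar_nonneg _) (gcpVar_pos ⟨i, hi⟩)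
  · rw [covariance_congr_ae (hsub s) (hsub t),
      covariance_sub_sub (hm₁ s) (hm₂ s) (hm₁ t) (hm₂ t),
      h₁.covariance_runningAverage_self hs hst, h₂.covariance_runningAverage_self hs hst,
      h₁.covariance_runningAverage_of_indepFun h₂ hind,
      h₂.covariance_runningAverage_of_indepFun h₁ hind.symm]
    ring
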